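/- Let $A$ be a unital $C^*$-algebra, let $U(A)=\{u\in A : uu^*=u^*u=1\}$ be its unitary group with the norm topology, and let $U_A$ be the connected component of the unit in $U(A)$. For $u\in U(A)$ let $\mathrm{Ad}(u):A\to A$, $\mathrm{Ad}(u)(a)=uau^*$. Let $B\subseteq A$ be a $C^*$-subalgebra, that is, a norm-closed $*$-subalgebra (not necessarily containing the unit of $A$). If $\mathrm{Ad}(u)(B)\subseteq B$ for all $u\in U_A$, then $\mathrm{Ad}(u)(B)\subseteq B$ for all $u\in U(A)$. -/

import Mathlib

/-!
Write `⁅x, y⁆ = x * y - y * x`. Differentiating `t ↦ exp (t • I • a) * b * star (exp (t • I • a))`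
at `0`, for `a` self-adjoint, shows that a closed subspace which is invariant under conjugation by
the identity component of the unitary group is a Lie ideal (`lie_mem_of_conj_mem`).

A subalgebra `B` that is a Lie ideal contains a large two-sided ideal: the largest ideal
`idealCore B` of `A` inside `B` contains all commutators of elements of `B`
(`lie_mem_idealCore_of_mem_of_mem`), by the identity `⁅x, y⁆ * a = ⁅x, y * a⁆ - y * ⁅x, a⁆`.
So `B` is commutative modulo its ideal core. A commutative C⋆-subalgebra that is a Lie ideal is
central: if `b ∈ B`, then `d = ⁅b, a⁆` lies in `B`, hence commutes with `b`, and `⁅b, ⁅b, a * a⁆⁆`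
vanishes and equals `2 d²`; when `a` and `b` are self-adjoint, `d` is skew-adjoint and so `d = 0`.
Carried out modulo the ideal core without passing to the quotient, this shows `⁅b, a⁆ ∈ idealCore B`
for all `b ∈ B` and `a : A` (`lie_mem_idealCore`); that `d² ∈ idealCore B` forces `d ∈ idealCore B`
is a functional calculus argument (`IsSelfAdjoint.mem_of_mul_self_mem`).

Finally, for any unitary `u`, the difference `u * b * star u - b = ⁅u, b⁆ * star u` lies in the
ideal core and hence in `B`.
-/

section IdealCore

variable {A : Type*} [Ring A] [Algebra ℂ A]

/-- The largest two-sided ideal of the unital algebra `A` contained in the subalgebra `B`, encoded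
as the subspace of all `x` such that `p * x * q ∈ B` for all `p q : A`. -/
def idealCore (B : NonUnitalSubalgebra ℂ A) : Submodule ℂ A where
  carrier := {x | ∀ p q : A, p * x * q ∈ B}
  zero_mem' p q := by simp
  add_mem' hx hy p q := by simpa [mul_add, add_mul] using add_mem (hx p q) (hy p q)
  smul_mem' c x hx p q := by simpa using SMulMemClass.smul_mem c (hx p q)

variable {B : NonUnitalSubalgebra ℂ A}

lemma mem_of_mem_idealCore {x : A} (hx : x ∈ idealCore B) : x ∈ B := by
  simpa using hx 1 1

lemma mul_mem_idealCore_left {x : A} (a : A) (hx : x ∈ idealCore B) : a * x ∈ idealCore B :=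
  fun p q ↦ by simpa [mul_assoc] using hx (p * a) q

lemma mul_mem_idealCore_right {x : A} (a : A) (hx : x ∈ idealCore B) : x * a ∈ idealCore B :=
  fun p q ↦ by simpa [mul_assoc] using hx p (a * q)

lemma isClosed_idealCore [TopologicalSpace A] [IsTopologicalRing A]
    (hB : IsClosed (B : Set A)) : IsClosed (idealCore B : Set A) := by
  have : (idealCore B : Set A) = ⋂ p : A, ⋂ q : A, (fun x ↦ p * x * q) ⁻¹' (B : Set A) := by
    ext x
    simp only [Set.mem_iInter]
    rfl
  rw [this]
  exact isClosed_iInter fun p ↦ isClosed_iInter fun q ↦ hB.preimage (by fun_prop)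

lemma lie_mem_idealCore_of_mem_of_mem (hLie : ∀ b ∈ B, ∀ a : A, ⁅b, a⁆ ∈ B) {x y : A}
    (hx : x ∈ B) (hy : y ∈ B) : ⁅x, y⁆ ∈ idealCore B := by
  have hr (a : A) : ⁅x, y⁆ * a ∈ B := by
    have h : ⁅x, y⁆ * a = ⁅x, y * a⁆ - y * ⁅x, a⁆ := by
      simp only [Ring.lie_def]; noncomm_ring
    rw [h]
    exact sub_mem (hLie x hx _) (mul_mem hy (hLie x hx a))
  intro p q
  have h : p * ⁅x, y⁆ * q = ⁅x, y⁆ * (q * p) - ⁅⁅x, y⁆ * q, p⁆ := by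
    simp only [Ring.lie_def]; noncomm_ring
  rw [h]
  exact sub_mem (hr _) (hLie _ (hr q) p)

/-- Modulo the ideal core, `ad b` squares to zero for `b ∈ B`; applied to `a * a`, Leibniz' rule
gives that `⁅b, a⁆` squares to zero. -/
lemma lie_mul_lie_mem_idealCore (hLie : ∀ b ∈ B, ∀ a : A, ⁅b, a⁆ ∈ B) {b : A} (hb : b ∈ B)
    (a : A) : ⁅b, a⁆ * ⁅b, a⁆ ∈ idealCore B := by
  have had (c : A) : ⁅b, ⁅b, c⁆⁆ ∈ idealCore B :=
    lie_mem_idealCore_of_mem_of_mem hLie hb (hLie b hb c)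
  have h : (2 : ℂ) • (⁅b, a⁆ * ⁅b, a⁆) =
      ⁅b, ⁅b, a * a⁆⁆ - ⁅b, ⁅b, a⁆⁆ * a - a * ⁅b, ⁅b, a⁆⁆ := by
    rw [two_smul]
    simp only [Ring.lie_def]; noncomm_ring
  rw [← Submodule.smul_mem_iff _ (two_ne_zero' ℂ), h]
  exact sub_mem (sub_mem (had _) (mul_mem_idealCore_right a (had a)))
    (mul_mem_idealCore_left a (had a))

end IdealCore

section CStarAlgebra

variable {A : Type*} [CStarAlgebra A]

/-- Closed right ideals contain a self-adjoint element as soon as they contain its square: `h` is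
the norm limit of `h² * (h * (h² + ε)⁻¹)` as `ε → 0`. -/
lemma IsSelfAdjoint.mem_of_mul_self_mem {h : A} (hh : IsSelfAdjoint h) {J : Submodule ℂ A}
    (hJ : IsClosed (J : Set A)) (hmul : ∀ x ∈ J, ∀ a : A, x * a ∈ J) (hsq : h * h ∈ J) :
    h ∈ J := by
  rw [← SetLike.mem_coe, ← hJ.closure_eq, Metric.mem_closure_iff]
  intro ε hε
  set g : ℝ → ℝ := fun x ↦ x / (x ^ 2 + ε ^ 2) with hg
  have hpos (x : ℝ) : 0 < x ^ 2 + ε ^ 2 := by positivity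
  have hgc : Continuous g := by
    rw [hg]
    exact continuous_id.div (by fun_prop) fun x ↦ (hpos x).ne'
  refine ⟨h * h * cfc g h, hmul _ hsq _, ?_⟩
  have hcfc : h - h * h * cfc g h = cfc (fun x : ℝ ↦ x - x * x * g x) h := by
    rw [cfc_sub (fun x : ℝ ↦ x) (fun x : ℝ ↦ x * x * g x) h,
      cfc_mul (fun x : ℝ ↦ x * x) g h, cfc_mul (fun x : ℝ ↦ x) (fun x : ℝ ↦ x) h, cfc_id' ℝ h]
  rw [dist_eq_norm, hcfc]
  -- The function is `x ε² / (x² + ε²)`, of absolute value at most `ε / 2`.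
  refine (norm_cfc_le (c := ε / 2) (by positivity) fun x _ ↦ ?_).trans_lt (by linarith)
  have hx : x - x * x * g x = x * ε ^ 2 / (x ^ 2 + ε ^ 2) := by
    have := (hpos x).ne'
    simp only [hg]
    field_simp
    ring
  rw [hx, Real.norm_eq_abs, abs_le, le_div_iff₀ (hpos x), div_le_iff₀ (hpos x)]
  constructor <;> nlinarith [mul_nonneg hε.le (sq_nonneg (x - ε)),
    mul_nonneg hε.le (sq_nonneg (x + ε))]

/-- The infinitesimal form of invariance under the identity component of the unitary group. -/
lemma lie_mem_of_conj_mem {V : Submodule ℂ A} (hV : IsClosed (V : Set A))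
    (hinv : ∀ u ∈ Subgroup.connectedComponentOfOne (unitary A),
      ∀ b ∈ V, Unitary.conjStarAlgAut ℂ A u b ∈ V)
    {b : A} (hb : b ∈ V) (a : A) : ⁅b, a⁆ ∈ V := by
  have hsa (a : selfAdjoint A) : ⁅b, (a : A)⁆ ∈ V := by
    set x : A := Complex.I • (a : A) with hx
    have hxs : star x = -x := by simp [hx, a.2.star_eq]
    have hmem (t : ℝ) : NormedSpace.exp (t • x) * b * star (NormedSpace.exp (t • x)) ∈ V := by
      have hu : selfAdjoint.expUnitary (t • a) ∈ Subgroup.connectedComponentOfOne (unitary A) :=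
        pathComponent_subset_component _ (selfAdjoint.joined_one_expUnitary (t • a))
      have hcoe : (selfAdjoint.expUnitary (t • a) : A) = NormedSpace.exp (t • x) := by
        rw [selfAdjoint.expUnitary_coe, hx, smul_comm t, selfAdjoint.val_smul]
      simpa only [Unitary.conjStarAlgAut_apply, hcoe] using hinv _ hu b hb
    have hexp : HasDerivAt (fun t : ℝ ↦ NormedSpace.exp (t • x)) x 0 := by
      simpa using hasDerivAt_exp_smul_const (𝕂 := ℝ) x 0
    have hder : HasDerivAt
        (fun t : ℝ ↦ NormedSpace.exp (t • x) * b * star (NormedSpace.exp (t • x)))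
        (x * b - b * x) 0 := by
      convert! (hexp.mul_const b).mul hexp.star using 1
      simp [hxs, sub_eq_add_neg]
    have hlim : x * b - b * x ∈ V := by
      refine hV.mem_of_tendsto hder.tendsto_slope (Filter.Eventually.of_forall fun t ↦ ?_)
      rw [slope_def_module]
      exact (V.restrictScalars ℝ).smul_mem _ (sub_mem (hmem t) (hmem 0))
    have h : ⁅b, (a : A)⁆ = Complex.I • (x * b - b * x) := by
      simp [hx, Ring.lie_def, ← smul_sub, smul_smul]
    rw [h]
    exact V.smul_mem _ hlim
  rw [← realPart_add_I_smul_imaginaryPart a]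
  have h : ⁅b, (realPart a : A) + Complex.I • (imaginaryPart a : A)⁆ =
      ⁅b, (realPart a : A)⁆ + Complex.I • ⁅b, (imaginaryPart a : A)⁆ := by
    simp only [Ring.lie_def, mul_add, add_mul, smul_sub, mul_smul_comm, smul_mul_assoc]
    abel
  rw [h]
  exact add_mem (hsa _) (V.smul_mem _ (hsa _))

/-- A C⋆-subalgebra that is a Lie ideal is central modulo its ideal core. -/
lemma lie_mem_idealCore {B : NonUnitalStarSubalgebra ℂ A} (hB : IsClosed (B : Set A))
    (hLie : ∀ b ∈ B, ∀ a : A, ⁅b, a⁆ ∈ B) {b : A} (hb : b ∈ B) (a : A) :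
    ⁅b, a⁆ ∈ idealCore B.toNonUnitalSubalgebra := by
  set J := idealCore B.toNonUnitalSubalgebra with hJ
  have hsa (b a : selfAdjoint A) (hb : (b : A) ∈ B) : ⁅(b : A), (a : A)⁆ ∈ J := by
    rw [← J.smul_mem_iff Complex.I_ne_zero]
    have hh : IsSelfAdjoint (Complex.I • ⁅(b : A), (a : A)⁆) := by
      simp [IsSelfAdjoint, Ring.lie_def, a.2.star_eq, b.2.star_eq, ← smul_neg]
    refine hh.mem_of_mul_self_mem (isClosed_idealCore hB)
      (fun x hx c ↦ mul_mem_idealCore_right c hx) ?_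
    rw [smul_mul_smul_comm]
    exact J.smul_mem _ (lie_mul_lie_mem_idealCore hLie hb _)
  have hre : (realPart b : A) ∈ B := by
    rw [realPart_apply_coe, ← Complex.coe_smul]
    exact SMulMemClass.smul_mem _ (add_mem hb (star_mem hb))
  have him : (imaginaryPart b : A) ∈ B := by
    rw [imaginaryPart_apply_coe, ← Complex.coe_smul]
    exact SMulMemClass.smul_mem _ (SMulMemClass.smul_mem _ (sub_mem hb (star_mem hb)))
  have h : ⁅b, a⁆ = ⁅(realPart b : A), (realPart a : A)⁆
      + Complex.I • ⁅(realPart b : A), (imaginaryPart a : A)⁆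
      + Complex.I • (⁅(imaginaryPart b : A), (realPart a : A)⁆
        + Complex.I • ⁅(imaginaryPart b : A), (imaginaryPart a : A)⁆) := by
    conv_lhs => rw [← realPart_add_I_smul_imaginaryPart a, ← realPart_add_I_smul_imaginaryPart b]
    simp only [Ring.lie_def, mul_add, add_mul, smul_sub, smul_add, mul_smul_comm, smul_mul_assoc]
    abel
  rw [h]
  exact add_mem (add_mem (hsa _ _ hre) (J.smul_mem _ (hsa _ _ hre)))
    (J.smul_mem _ (add_mem (hsa _ _ him) (J.smul_mem _ (hsa _ _ him))))

end CStarAlgebra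

/-- A C*-subalgebra `B` (a norm-closed *-subalgebra, not assumed to contain the unit of `A`) that
is invariant under `Ad u : a ↦ u * a * star u` for every `u` in the identity component of the
unitary group (with the norm topology) is invariant under `Ad u` for every unitary `u`. -/
theorem mainTheorem11 {A : Type*} [CStarAlgebra A]
    (B : NonUnitalStarSubalgebra ℂ A) (hB : IsClosed (B : Set A))
    (hinv : ∀ u ∈ Subgroup.connectedComponentOfOne (unitary A),
      ∀ b ∈ B, Unitary.conjStarAlgAut ℂ A u b ∈ B) :
    ∀ u : unitary A, ∀ b ∈ B, Unitary.conjStarAlgAut ℂ A u b ∈ B := by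
  intro u b hb
  have hLie : ∀ b ∈ B, ∀ a : A, ⁅b, a⁆ ∈ B := fun b hb a ↦
    lie_mem_of_conj_mem (V := B.toNonUnitalSubalgebra.toSubmodule) hB hinv hb a
  have hcore := mul_mem_idealCore_right (star (u : A)) (lie_mem_idealCore hB hLie hb (u : A))
  have h : Unitary.conjStarAlgAut ℂ A u b = b - ⁅b, (u : A)⁆ * star (u : A) := by
    rw [Unitary.conjStarAlgAut_apply, Ring.lie_def, sub_mul, mul_assoc b,
      Unitary.mul_star_self_of_mem u.2, mul_one, sub_sub_cancel]
  rw [h]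
  exact sub_mem hb (mem_of_mem_idealCore hcore)
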